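/- Let $d\ge 1$, let $\mathbb M$ be a Polish space with its Borel $\sigma$-algebra, and let $X_M=\sum_{n\ge1}\delta_{(X_n,M_n)}$ be a marked point process on $\mathbb R^d$ with marks in $\mathbb M$, i.e. a random counting measure on $\mathbb R^d\times\mathbb M$ with $X_M(B\times\mathbb M)<\infty$ for all bounded Borel sets $B$. Assume that $X_M$ is simple (almost surely no location carries more than one atom), that its law is invariant under shifts of the locations, that its intensity $\lambda=\mathbb E X_M([0,1)^d\times\mathbb M)$ is positive, and that $\mathbb E\bigl[X_M([0,1)^d\times\mathbb M)^2\bigr]<\infty$. Write $P_M^{o}(C)=\lambda^{-1}\,\mathbb E X_M([0,1)^d\times C)$ for the Palm mark distribution. Write $\alpha^{(2)}_{X_M}$ and $\alpha^{(2)}_X$ for the second factorial moment measures of $X_M$ and of the process of locations $X=\sum_n\delta_{X_n}$, $$\alpha^{(2)}_{X_M}\bigl((B_1\times C_1)\times(B_2\times C_2)\bigr)=\mathbb E\sum_{p\ne q}\mathbf 1_{B_1}(X_p)\mathbf 1_{C_1}(M_p)\mathbf 1_{B_2}(X_q)\mathbf 1_{C_2}(M_q),\qquad \alpha_X^{(2)}(B_1\times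 B_2)=\alpha^{(2)}_{X_M}\bigl((B_1\times\mathbb M)\times(B_2\times\mathbb M)\bigr),$$ and $\alpha^{(2)}_{X,red}$ for the reduced second factorial moment measure, which is determined by $\alpha_X^{(2)}(B_1\times B_2)=\lambda\int_{B_1}\alpha_{X,red}^{(2)}(B_2-x)\,dx$; equivalently, $\alpha_{X,red}^{(2)}(B)=\lambda^{-1}\,\mathbb E\sum_{p\neq q}\mathbf 1_{[0,1)^d}(X_p)\,\mathbf 1_B(X_q-X_p)$. Let $x\mapsto P_M^{o,x}$ be (any version of) the two-point Palm mark distribution: a stochastic kernel from $\mathbb R^d$ to $\mathbb M^2$ such that $$\alpha^{(2)}_{X_M}\bigl((B_1\times C_1)\times(B_2\times C_2)\bigr)=\int_{B_1\times B_2}P_M^{o,y-x}(C_1\times C_2)\,\alpha_X^{(2)}(d(x,y))$$ for all Borel sets $B_1,B_2\subseteq\mathbb R^d$ and $C_1,C_2\subseteq\mathbb M$. Suppose that for all Borel sets $C_1,C_2\subseteq\mathbb M$ $$\int_{\mathbb R^d}\bigl|P_M^{o,x}(C_1\times C_2)-P_M^{o}(C_1)P_M^{o}(C_2)\bigr|\,\alpha^{(2)}_{X,red}(dx)<\infty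 .$$ Let $W_1\subseteq W_2\subseteq\cdots$ be convex compact subsets of $\mathbb R^d$ whose inradii tend to infinity, let $C_1,\dots,C_\ell\subseteq\mathbb M$ be Borel sets, and put $$Y_k(C)=|W_k|^{-1/2}\sum_{n\ge 1}\mathbf 1_{W_k}(X_n)\bigl(\mathbf 1_C(M_n)-P_M^{o}(C)\bigr).$$ Then, for all $i,j\in\{1,\dots,\ell\}$, the limit $\sigma_{ij}=\lim_{k\to\infty}\mathbb E\,Y_k(C_i)Y_k(C_j)$ exists and $$\sigma_{ij}=\lambda\bigl(P_M^{o}(C_i\cap C_j)-P_M^{o}(C_i)P_M^{o}(C_j)\bigr)+\lambda\int_{\mathbb R^d}\Bigl(P_M^{o,x}(C_i\times C_j)-P_M^{o,x}(C_i\times\mathbb M)P_M^{o}(C_j)-P_M^{o,x}(C_j\times\mathbb M)P_M^{o}(C_i)+P_M^{o}(C_i)P_M^{o}(C_j)\Bigr)\alpha^{(2)}_{X,red}(dx),$$ where the expectations and the integral converge absolutely. In particular, if $X_M$ is independently marked, i.e. it has the law of a point process whose points carry i.i.d. marks that are independent of the locations, then $\sigma_{ij}=\lambda\bigl(P_M^{o}(C_i\cap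 C_j)-P_M^{o}(C_i)P_M^{o}(C_j)\bigr)$. -/

import Mathlib

open MeasureTheory ProbabilityTheory Filter Topology
open scoped ENNReal

noncomputable section

namespace MPP

/-- The location space `ℝ^d` with its Euclidean norm and Lebesgue measure. -/
abbrev Loc (d : ℕ) : Type := EuclideanSpace ℝ (Fin d)

/-- Marked configurations: counting measures `φ` on `ℝ^d × M` (measures with values in `ℕ ∪ {∞}`)
such that `φ (B × M) < ∞` for all bounded Borel sets `B`. -/
def Config (d : ℕ) (M : Type*) [MeasurableSpace M] : Type _ :=
  {φ : Measure (Loc d × M) //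
    (∀ A, MeasurableSet A → ∃ n : ℕ∞, φ A = (n : ℝ≥0∞)) ∧
    ∀ B : Set (Loc d), Bornology.IsBounded B → MeasurableSet B → φ (B ×ˢ Set.univ) < ∞}

/-- The `σ`-algebra generated by the sets `{φ | φ (B × C) = j}`, with `j` a natural number, `B` a
bounded Borel set, and `C` a measurable set of marks. -/
instance (d : ℕ) (M : Type*) [MeasurableSpace M] : MeasurableSpace (Config d M) :=
  MeasurableSpace.generateFrom
    {S | ∃ (B : Set (Loc d)) (C : Set M) (j : ℕ), Bornology.IsBounded B ∧ MeasurableSet B ∧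
      MeasurableSet C ∧ S = {φ : Config d M | φ.1 (B ×ˢ C) = (j : ℝ≥0∞)}}

variable {d : ℕ} {M : Type*} [MeasurableSpace M] {Ω : Type*} [MeasurableSpace Ω]

lemma measurable_shiftMap (x : Loc d) :
    Measurable (fun z : Loc d × M => (z.1 - x, z.2)) := by fun_prop

/-- The shift of the locations by `-x`: the atom `(y, m)` is moved to `(y - x, m)`. -/
def Config.shift (x : Loc d) (φ : Config d M) : Config d M :=
  ⟨φ.1.map (fun z => (z.1 - x, z.2)), by
    refine ⟨fun A hA => ?_, fun B hB hBm => ?_⟩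
    · rw [Measure.map_apply (measurable_shiftMap x) hA]
      exact φ.2.1 _ (measurable_shiftMap x hA)
    · rw [Measure.map_apply (measurable_shiftMap x) (hBm.prod MeasurableSet.univ)]
      have h1 : (fun z : Loc d × M => (z.1 - x, z.2)) ⁻¹' (B ×ˢ Set.univ)
          = ((fun y : Loc d => y + -x) ⁻¹' B) ×ˢ Set.univ := by
        ext z; simp [sub_eq_add_neg]
      rw [h1]
      refine φ.2.2 _ ?_ (by measurability)
      have h2 : (fun y : Loc d => y + -x) ⁻¹' B = (fun y : Loc d => y + x) '' B := by
        ext y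
        constructor
        · intro hy
          exact ⟨y + -x, hy, by simp⟩
        · rintro ⟨w, hw, rfl⟩
          simpa using hw
      rw [h2]
      obtain ⟨r, hr⟩ := hB.exists_norm_le
      refine isBounded_iff_forall_norm_le.2 ⟨r + ‖x‖, ?_⟩
      rintro _ ⟨w, hw, rfl⟩
      exact (norm_add_le _ _).trans (by linarith [hr w hw])⟩

/-- Almost surely every location carries at most one atom, whatever its mark. -/
def IsSimple (P : Measure Ω) (X : Ω → Config d M) : Prop :=
  ∀ᵐ ω ∂P, ∀ x : Loc d, (X ω).1 ({x} ×ˢ Set.univ) ≤ 1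

/-- The law of the marked point process is invariant under shifts of the locations. -/
def IsStationary (P : Measure Ω) (X : Ω → Config d M) : Prop :=
  ∀ x : Loc d, IdentDistrib (fun ω => (X ω).shift x) X P P

/-- The cube `[0,1)^d`. -/
def unitCube (d : ℕ) : Set (Loc d) := {x | ∀ i, 0 ≤ x i ∧ x i < 1}

/-- The intensity `λ = E X([0,1)^d × M)`. -/
def intensity (P : Measure Ω) (X : Ω → Config d M) : ℝ≥0∞ :=
  ∫⁻ ω, (X ω).1 (unitCube d ×ˢ Set.univ) ∂P

/-- The Palm mark probability `P_M^o(C) = λ⁻¹ E X([0,1)^d × C)`. -/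
def palmMark (P : Measure Ω) (X : Ω → Config d M) (C : Set M) : ℝ :=
  ((intensity P X)⁻¹ * ∫⁻ ω, (X ω).1 (unitCube d ×ˢ C) ∂P).toReal

/-- The second factorial moment measure of the marked process,
`A ↦ E ∑_{p ≠ q} 1_A((X_p, M_p), (X_q, M_q))`.  For a simple configuration `φ` the sum over ordered
pairs of distinct atoms is the product measure `φ ⊗ φ` restricted to the complement of the
diagonal. -/
def factorialMoment (P : Measure Ω) (X : Ω → Config d M) :
    Measure ((Loc d × M) × (Loc d × M)) :=
  P.bind fun ω => ((X ω).1.prod (X ω).1).restrict {p | p.1 ≠ p.2}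

/-- The second factorial moment measure of the process of locations. -/
def locFactorialMoment (P : Measure Ω) (X : Ω → Config d M) : Measure (Loc d × Loc d) :=
  (factorialMoment P X).map fun p => (p.1.1, p.2.1)

/-- The reduced second factorial moment measure of the process of locations,
`B ↦ λ⁻¹ E ∑_{p ≠ q} 1_{[0,1)^d}(X_p) 1_B(X_q - X_p)`. -/
def reducedMoment (P : Measure Ω) (X : Ω → Config d M) : Measure (Loc d) :=
  (intensity P X)⁻¹ •
    ((locFactorialMoment P X).restrict (unitCube d ×ˢ Set.univ)).map fun p => p.2 - p.1

/-- `κ x = P_M^{o,x}` is (a version of) the two-point Palm mark distribution of a stationary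
process: `P_M^{x,y} = κ (y - x)` is a regular conditional distribution of the two marks given the
two locations, that is, a Radon-Nikodym density of the marked second factorial moment measure with
respect to that of the locations. -/
def IsTwoPointPalm (P : Measure Ω) (X : Ω → Config d M) (κ : Kernel (Loc d) (M × M)) : Prop :=
  IsMarkovKernel κ ∧
  ∀ (B₁ B₂ : Set (Loc d)) (C₁ C₂ : Set M), MeasurableSet B₁ → MeasurableSet B₂ →
    MeasurableSet C₁ → MeasurableSet C₂ →
    factorialMoment P X ((B₁ ×ˢ C₁) ×ˢ (B₂ ×ˢ C₂)) =
      ∫⁻ p in B₁ ×ˢ B₂, κ (p.2 - p.1) (C₁ ×ˢ C₂) ∂(locFactorialMoment P X)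

/-- Independent marking: the process has the law of `∑_{n < N} δ_{(X_n, M_n)}`, where the marks
`M_0, M_1, …` are independent with a common law `Q`, and the sequence of marks is independent of
the locations, that is, of `(N, X_0, X_1, …)` (whose law is `ν`; `N = ∞` is allowed). -/
def IsIndependentlyMarked (P : Measure Ω) (X : Ω → Config d M) : Prop :=
  ∃ (ν : Measure (ℕ∞ × (ℕ → Loc d))) (Q : Measure M) (_ : IsProbabilityMeasure ν)
    (_ : IsProbabilityMeasure Q),
    P.map (fun ω => (X ω).1) =
      (ν.prod (Measure.infinitePi fun _ : ℕ => Q)).map fun s =>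
        Measure.sum fun n : ℕ =>
          if (n : ℕ∞) < s.1.1 then Measure.dirac (s.1.2 n, s.2 n) else 0

/-- The inradius `ϱ(W) = sup {r > 0 : B(x,r) ⊆ W for some x ∈ W}`, as an extended number. -/
def inradius (W : Set (Loc d)) : ℝ≥0∞ :=
  sSup {ρ | ∃ r : ℝ, 0 < r ∧ ρ = ENNReal.ofReal r ∧ ∃ x ∈ W, Metric.closedBall x r ⊆ W}

/-- Convex averaging sequences: increasing sequences of convex compact sets whose inradii tend to
infinity. -/
structure IsConvexAveraging (W : ℕ → Set (Loc d)) : Prop where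
  mono : Monotone W
  convex : ∀ k, Convex ℝ (W k)
  compact : ∀ k, IsCompact (W k)
  inradius_tendsto : Tendsto (fun k => inradius (W k)) atTop (𝓝 ∞)

/-- The scaled deviation `|W|^{-1/2} ∑_n 1_W(X_n) (1_C(M_n) - P_M^o(C))`; the sum over the atoms
is the integral with respect to the configuration. -/
def deviation (P : Measure Ω) (X : Ω → Config d M) (W : Set (Loc d)) (C : Set M) (ω : Ω) : ℝ :=
  (√(volume W).toReal)⁻¹ *
    ∫ z, W.indicator (fun _ => (1 : ℝ)) z.1 *
      (C.indicator (fun _ => (1 : ℝ)) z.2 - palmMark P X C) ∂(X ω).1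

/-- The integrand `P_M^{o,x}(C × D) - P_M^{o,x}(C × M) P_M^o(D) - P_M^{o,x}(D × M) P_M^o(C)
+ P_M^o(C) P_M^o(D)`. -/
def covIntegrand (P : Measure Ω) (X : Ω → Config d M) (κ : Kernel (Loc d) (M × M))
    (C D : Set M) (x : Loc d) : ℝ :=
  (κ x).real (C ×ˢ D) - (κ x).real (C ×ˢ Set.univ) * palmMark P X D
    - (κ x).real (D ×ˢ Set.univ) * palmMark P X C + palmMark P X C * palmMark P X D

end MPP

end

/-! Write `w(u)` for the volume of `W ∩ (W - u)` and `p` for the Palm mark distribution. Expanding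
the product of two deviations reduces their covariance in a window `W` to mixed moments `E X(W × C)
X(W × D)`. For a simple process each mixed moment splits along the diagonal (`Config.mul_eq_add`):
by stationarity, coincident atoms give `λ p(C ∩ D) |W|`, and distinct atoms give the factorial
moment measure of `(W × C) × (W × D)`.

In the coordinates `(x, y - x)` the factorial moment measure of the locations is Lebesgue measure
times `λ` times the reduced one (`map_locFactorialMoment`). Disintegrating the marks by `κ` and
integrating out `x` turns the second part into `λ ∫ w(u) κ_u(C × D)`
(`factorialMoment_rect_eq_lintegral`). The combination of the four mixed moments is thus an exact
formula for each bounded window, with `covIntegrand` weighted by `w(u) / |W|`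
(`integral_deviation_mul_eq`).

For large convex windows this weight tends to `1` and never exceeds `1`
(`tendsto_volume_inter_div`), while `covIntegrand` is integrable because it is a linear combination
of three differences controlled by the mixing hypothesis. Dominated convergence gives the limit.

Under independent marking the covariance is computed directly, without `κ`: distinct points
contribute nothing, and the covariance is already constant in every window of positive volume. -/

namespace MPP

/-! ### Measurability of configurations and of their product measures -/

section Measurability

/-- The slab of marked points whose location lies in the closed ball of radius `n` at the origin. -/
def slab (d : ℕ) (M : Type*) (n : ℕ) : Set (Loc d × M) :=
  Metric.closedBall (0 : Loc d) n ×ˢ Set.univ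

lemma monotone_slab {d : ℕ} {M : Type*} : Monotone (slab d M) := fun _ _ h =>
  Set.prod_mono (Metric.closedBall_subset_closedBall (by exact_mod_cast h)) le_rfl

lemma iUnion_slab {d : ℕ} {M : Type*} : ⋃ n, slab d M n = Set.univ := by
  refine Set.eq_univ_of_forall fun z => Set.mem_iUnion.2 ?_
  obtain ⟨n, hn⟩ := exists_nat_ge ‖z.1‖
  exact ⟨n, by simpa [slab] using hn⟩

lemma iUnion_slab_prod {d : ℕ} {M : Type*} :
    ⋃ n, slab d M n ×ˢ slab d M n = Set.univ := by
  rw [Set.iUnion_prod_of_monotone monotone_slab monotone_slab, iUnion_slab, Set.univ_prod_univ]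

variable {d : ℕ} {M : Type*} [MeasurableSpace M]

lemma measurableSet_slab (n : ℕ) : MeasurableSet (slab d M n) :=
  Metric.isClosed_closedBall.measurableSet.prod MeasurableSet.univ

/-- The measure underlying a configuration. -/
def Config.toMeasure (φ : Config d M) : Measure (Loc d × M) := Subtype.val φ

lemma Config.lt_top (φ : Config d M) {B : Set (Loc d)} (hb : Bornology.IsBounded B)
    (hB : MeasurableSet B) (C : Set M) : φ.toMeasure (B ×ˢ C) < ∞ :=
  (measure_mono (Set.prod_mono le_rfl (Set.subset_univ C))).trans_lt (φ.2.2 B hb hB)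

lemma Config.slab_lt_top (φ : Config d M) (n : ℕ) : φ.toMeasure (slab d M n) < ∞ :=
  φ.lt_top Metric.isBounded_closedBall Metric.isClosed_closedBall.measurableSet _

instance (φ : Config d M) : SigmaFinite φ.toMeasure :=
  ⟨⟨⟨slab d M, fun _ => trivial, φ.slab_lt_top, iUnion_slab⟩⟩⟩

instance (φ : Config d M) (n : ℕ) : IsFiniteMeasure (φ.toMeasure.restrict (slab d M n)) :=
  ⟨by simpa using φ.slab_lt_top n⟩

lemma Config.exists_nat_eq (φ : Config d M) {A : Set (Loc d × M)} (hA : MeasurableSet A)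
    (h : φ.toMeasure A ≠ ∞) : ∃ n : ℕ, φ.toMeasure A = n := by
  obtain ⟨n, hn⟩ : ∃ n : ℕ∞, φ.toMeasure A = n := φ.2.1 A hA
  rw [hn] at h ⊢
  lift n to ℕ using (by simpa using h)
  exact ⟨n, by simp⟩

/-- The generating sets are exactly the level sets of this count. It is finite on bounded `B`, hence
a natural number, hence a countable sum of multiples of indicators of generating sets. -/
lemma measurable_config_rect {B : Set (Loc d)} {C : Set M} (hb : Bornology.IsBounded B)
    (hB : MeasurableSet B) (hC : MeasurableSet C) :
    Measurable fun φ : Config d M => φ.toMeasure (B ×ˢ C) := by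
  have key : (fun φ : Config d M => φ.toMeasure (B ×ˢ C)) = fun φ =>
      ∑' j : ℕ, {φ : Config d M | φ.toMeasure (B ×ˢ C) = (j : ℝ≥0∞)}.indicator
        (fun _ => (j : ℝ≥0∞)) φ := by
    funext φ
    obtain ⟨n, hn⟩ := φ.exists_nat_eq (hB.prod hC) (φ.lt_top hb hB C).ne
    rw [tsum_eq_single n]
    · simp [hn]
    · intro m hm
      simp [hn, hm.symm]
  rw [key]
  exact .tsum fun j => measurable_const.indicator
    (MeasurableSpace.measurableSet_generateFrom ⟨B, C, j, hb, hB, hC, rfl⟩)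

/-- Cutting down to a slab makes the measure finite, so that rectangles, a π-system, decide
measurability. The slabs then exhaust the space by monotone limits. -/
lemma measurable_config_restrict (n : ℕ) :
    Measurable fun φ : Config d M => φ.toMeasure.restrict (slab d M n) := by
  have key (B : Set (Loc d)) (C : Set M) (hB : MeasurableSet B) (hC : MeasurableSet C) :
      Measurable fun φ : Config d M => φ.toMeasure.restrict (slab d M n) (B ×ˢ C) := by
    simp_rw [Measure.restrict_apply (hB.prod hC), slab, Set.prod_inter_prod, Set.inter_univ]
    exact measurable_config_rect (Metric.isBounded_closedBall.subset Set.inter_subset_right)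
      (hB.inter Metric.isClosed_closedBall.measurableSet) hC
  refine Measurable.measure_of_isPiSystem generateFrom_prod.symm isPiSystem_prod ?_ ?_
  · rintro _ ⟨B, hB, C, hC, rfl⟩
    exact key B C hB hC
  · rw [← Set.univ_prod_univ]
    exact key _ _ MeasurableSet.univ MeasurableSet.univ

lemma measure_eq_iSup_restrict {α : Type*} [MeasurableSpace α] (μ : Measure α) {s : ℕ → Set α}
    (hs : Monotone s) (hU : ⋃ n, s n = Set.univ) {A : Set α} (hA : MeasurableSet A) :
    μ A = ⨆ n, μ.restrict (s n) A := by
  simp_rw [Measure.restrict_apply hA]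
  rw [← Monotone.measure_iUnion (fun _ _ h => Set.inter_subset_inter_right A (hs h)),
    ← Set.inter_iUnion, hU, Set.inter_univ]

@[fun_prop]
lemma measurable_toMeasure : Measurable (Config.toMeasure (d := d) (M := M)) := by
  refine Measure.measurable_of_measurable_coe _ fun A hA => ?_
  simp_rw [fun φ : Config d M =>
    measure_eq_iSup_restrict φ.toMeasure monotone_slab iUnion_slab hA]
  exact .iSup fun n => (Measure.measurable_coe hA).comp (measurable_config_restrict n)

@[fun_prop]
lemma measurable_toMeasure_prod :
    Measurable fun φ : Config d M => φ.toMeasure.prod φ.toMeasure := by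
  refine Measure.measurable_of_measurable_coe _ fun A hA => ?_
  simp_rw [fun φ : Config d M => measure_eq_iSup_restrict (φ.toMeasure.prod φ.toMeasure)
    (fun _ _ h => Set.prod_mono (monotone_slab h) (monotone_slab h)) iUnion_slab_prod hA,
    ← Measure.prod_restrict]
  refine .iSup fun n => (Measure.measurable_coe hA).comp ?_
  have key (S T : Set (Loc d × M)) (hS : MeasurableSet S) (hT : MeasurableSet T) :
      Measurable fun φ : Config d M => ((φ.toMeasure.restrict (slab d M n)).prod
        (φ.toMeasure.restrict (slab d M n))) (S ×ˢ T) := by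
    simp_rw [Measure.prod_prod]
    exact ((Measure.measurable_coe hS).comp (measurable_config_restrict n)).mul
      ((Measure.measurable_coe hT).comp (measurable_config_restrict n))
  refine Measurable.measure_of_isPiSystem generateFrom_prod.symm isPiSystem_prod ?_ ?_
  · rintro _ ⟨S, hS, T, hT, rfl⟩
    exact key S T hS hT
  · rw [← Set.univ_prod_univ]
    exact key _ _ MeasurableSet.univ MeasurableSet.univ

/-- `Measure.bind` averages a family of measures as intended only when the family is measurable; the
preceding lemmas supply this. -/
lemma factorialMoment_apply [MeasurableEq (Loc d × M)] {Ω : Type*} [MeasurableSpace Ω]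
    {P : Measure Ω} {X : Ω → Config d M} (hX : Measurable X)
    {A : Set ((Loc d × M) × (Loc d × M))} (hA : MeasurableSet A) :
    factorialMoment P X A =
      ∫⁻ ω, ((X ω).toMeasure.prod (X ω).toMeasure) (A ∩ {p | p.1 ≠ p.2}) ∂P := by
  have hD : MeasurableSet {p : (Loc d × M) × (Loc d × M) | p.1 ≠ p.2} :=
    measurableSet_diagonal.compl
  have hm : Measurable fun ω => ((X ω).toMeasure.prod (X ω).toMeasure).restrict
      {p : (Loc d × M) × (Loc d × M) | p.1 ≠ p.2} :=
    Measure.measurable_of_measurable_coe _ fun B hB => by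
      simp_rw [Measure.restrict_apply hB]
      exact (Measure.measurable_coe (hB.inter hD)).comp (measurable_toMeasure_prod.comp hX)
  refine (Measure.bind_apply hA hm.aemeasurable).trans ?_
  simp_rw [Measure.restrict_apply hA]

end Measurability

/-! ### Atoms of simple configurations -/

section Atoms

variable {d : ℕ} {M : Type*} [TopologicalSpace M] [PolishSpace M] [MeasurableSpace M] [BorelSpace M]

/-- A finite measure with values in `ℕ` and without atoms vanishes. -/
lemma eq_zero_of_forall_exists_nat {α : Type*} [TopologicalSpace α] [SecondCountableTopology α]
    [T1Space α] [MeasurableSpace α] [OpensMeasurableSpace α] (μ : Measure α) [IsFiniteMeasure μ]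
    (hμ : ∀ A, MeasurableSet A → ∃ n : ℕ, μ A = n) (h0 : ∀ x, μ {x} = 0) : μ = 0 := by
  rw [← Measure.measure_univ_eq_zero]
  refine measure_null_of_locally_null _ fun x _ => ?_
  obtain ⟨u, hu, hu'⟩ := (nhds_basis_opens x).exists_antitone_subbasis
  have hx : ⋂ n, u n = {x} := by
    rw [← ker_nhds, hu'.1.ker]
    simp
  -- The masses of shrinking neighbourhoods of `x` tend to `μ {x} = 0`; being natural numbers, they
  -- are eventually zero. So `μ` is locally null.
  have ht := tendsto_measure_iInter_atTop (μ := μ) (s := u)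
    (fun n => (hu n).2.measurableSet.nullMeasurableSet) hu'.antitone ⟨0, measure_ne_top _ _⟩
  rw [hx, h0] at ht
  obtain ⟨n, hn⟩ := (ht.eventually_lt_const one_pos).exists
  refine ⟨u n, mem_nhdsWithin_of_mem_nhds (hu'.mem n), ?_⟩
  obtain ⟨k, hk⟩ := hμ _ (hu n).2.measurableSet
  rw [Function.comp_apply, hk] at hn
  rw [hk]
  have : k < 1 := by exact_mod_cast hn
  simp [show k = 0 by omega]

/-- Almost every point of a configuration whose atoms have mass at most one has mass one. -/
lemma Config.ae_singleton_eq_one (φ : Config d M) (h : ∀ z, φ.toMeasure {z} ≤ 1) :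
    ∀ᵐ z ∂φ.toMeasure, φ.toMeasure {z} = 1 := by
  have hmeas : Measurable fun z => φ.toMeasure {z} := by
    have : MeasurableSet {p : (Loc d × M) × (Loc d × M) | p.2 = p.1} :=
      measurableSet_eq_fun measurable_snd measurable_fst
    exact measurable_measure_prodMk_left this
  set Z : Set (Loc d × M) := {z | φ.toMeasure {z} = 0}
  have hZ : MeasurableSet Z := hmeas (measurableSet_singleton 0)
  -- On `Z` the configuration has no atoms; within a slab it is also finite and integer valued, so
  -- it vanishes there.
  have hn (n : ℕ) : φ.toMeasure.restrict (Z ∩ slab d M n) = 0 := by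
    have hlt : φ.toMeasure (Z ∩ slab d M n) < ∞ :=
      (measure_mono Set.inter_subset_right).trans_lt (φ.slab_lt_top n)
    have : IsFiniteMeasure (φ.toMeasure.restrict (Z ∩ slab d M n)) := ⟨by simpa using hlt⟩
    refine eq_zero_of_forall_exists_nat _ (fun A hA => ?_) fun z => ?_
    · rw [Measure.restrict_apply hA]
      exact φ.exists_nat_eq (hA.inter (hZ.inter (measurableSet_slab n)))
        ((measure_mono Set.inter_subset_right).trans_lt hlt).ne
    · rw [Measure.restrict_apply (measurableSet_singleton z)]
      by_cases hz : z ∈ Z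
      · exact measure_mono_null Set.inter_subset_left hz
      · rw [Set.singleton_inter_eq_empty.2 fun h => hz h.1, measure_empty]
  have hZ0 : φ.toMeasure Z = 0 := by
    rw [← Set.inter_univ Z, ← iUnion_slab, Set.inter_iUnion, measure_iUnion_null_iff]
    exact fun n => Measure.restrict_eq_zero.1 (hn n)
  filter_upwards [compl_mem_ae_iff.2 hZ0] with z hz
  obtain ⟨k, hk⟩ := φ.exists_nat_eq (measurableSet_singleton z) ((h z).trans_lt ENNReal.one_lt_top).ne
  have h1 := h z
  have h2 : φ.toMeasure {z} ≠ 0 := hz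
  rw [hk] at h1 h2 ⊢
  have h3 : k ≤ 1 := by exact_mod_cast h1
  have h4 : k ≠ 0 := by exact_mod_cast h2
  simp [show k = 1 by omega]

/-- Split `φ ⊗ φ` along the diagonal. The diagonal has slice `{z}` over `z`, of mass one for
`φ`-almost every `z` by simplicity, so its part of `A × B` has mass `φ (A ∩ B)`. -/
lemma Config.mul_eq_add (φ : Config d M) (h : ∀ x, φ.toMeasure ({x} ×ˢ Set.univ) ≤ 1)
    {A B : Set (Loc d × M)} (hA : MeasurableSet A) (hB : MeasurableSet B) :
    φ.toMeasure A * φ.toMeasure B = φ.toMeasure (A ∩ B) +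
      (φ.toMeasure.prod φ.toMeasure) ((A ×ˢ B) ∩ {p | p.1 ≠ p.2}) := by
  have hD : MeasurableSet (Set.diagonal (Loc d × M)) := measurableSet_diagonal
  rw [← Measure.prod_prod, ← measure_inter_add_sdiff (A ×ˢ B) hD]
  congr 1
  rw [Measure.prod_apply ((hA.prod hB).inter hD)]
  have hs (z : Loc d × M) : Prod.mk z ⁻¹' ((A ×ˢ B) ∩ Set.diagonal _) = {z} ∩ (A ∩ B) := by
    ext w
    simp only [Set.mem_preimage, Set.mem_inter_iff, Set.mem_prod, Set.mem_diagonal_iff,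
      Set.mem_singleton_iff]
    constructor
    · rintro ⟨⟨h1, h2⟩, rfl⟩
      exact ⟨rfl, h1, h2⟩
    · rintro ⟨rfl, h1, h2⟩
      exact ⟨⟨h1, h2⟩, rfl⟩
  have h1 (z : Loc d × M) : φ.toMeasure {z} ≤ 1 :=
    (measure_mono (by simp)).trans (h z.1)
  rw [← lintegral_indicator_one (hA.inter hB)]
  refine lintegral_congr_ae ?_
  filter_upwards [φ.ae_singleton_eq_one h1] with z hz
  rw [hs]
  by_cases hzz : z ∈ A ∩ B
  · rw [Set.inter_eq_left.2 (Set.singleton_subset_iff.2 hzz), hz, Set.indicator_of_mem hzz]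
    rfl
  · rw [Set.singleton_inter_eq_empty.2 hzz, measure_empty, Set.indicator_of_notMem hzz]

end Atoms

end MPP

namespace MPP

/-! ### Translation invariant measures and the unit cube -/

section UnitCube

variable {d : ℕ}

lemma unitCube_eq_preimage :
    unitCube d = (@WithLp.ofLp 2 (Fin d → ℝ)) ⁻¹' (Set.univ.pi fun _ => Set.Ico 0 1) := by
  ext x
  simp [unitCube]

lemma measurableSet_unitCube : MeasurableSet (unitCube d) := by
  rw [unitCube_eq_preimage]
  exact (PiLp.volume_preserving_ofLp (Fin d)).measurable
    (MeasurableSet.univ_pi fun _ => measurableSet_Ico)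

lemma volume_unitCube : volume (unitCube d) = 1 := by
  rw [unitCube_eq_preimage, (PiLp.volume_preserving_ofLp (Fin d)).measure_preimage
    (MeasurableSet.univ_pi fun _ => measurableSet_Ico).nullMeasurableSet, volume_pi_pi]
  simp

lemma isBounded_unitCube : Bornology.IsBounded (unitCube d) := by
  refine isBounded_iff_forall_norm_le.2 ⟨√d, fun x hx => ?_⟩
  rw [EuclideanSpace.norm_eq]
  refine Real.sqrt_le_sqrt ?_
  calc ∑ i, ‖x i‖ ^ 2 ≤ ∑ _i : Fin d, (1 : ℝ) := Finset.sum_le_sum fun i _ => by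
        have := hx i
        rw [Real.norm_eq_abs, sq_abs]
        nlinarith
    _ = d := by simp

lemma exists_finset_subset_iUnion_unitCube {B : Set (Loc d)} (hB : Bornology.IsBounded B) :
    ∃ T : Finset (Loc d), B ⊆ ⋃ x ∈ T, (fun y => y - x) ⁻¹' unitCube d := by
  -- The half-open cube is not open, so compactness is applied to translates of its interior, each
  -- `y` lying at the centre of one of them.
  let U : Set (Loc d) := {y | ∀ i, 0 < y i ∧ y i < 1}
  have hU : IsOpen U := by
    simp only [U, Set.ofPred_forall]
    refine isOpen_iInter_of_finite fun i => ?_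
    have hc : Continuous fun y : Loc d => y i := by fun_prop
    exact (isOpen_lt continuous_const hc).inter (isOpen_lt hc continuous_const)
  obtain ⟨T, hT⟩ := (hB.isCompact_closure).elim_finite_subcover
    (fun x : Loc d => (fun y => y - x) ⁻¹' U)
    (fun x => hU.preimage (by fun_prop)) (fun y _ => Set.mem_iUnion.2
      ⟨y - WithLp.toLp 2 (fun _ => 1 / 2), by
        simp only [U, Set.mem_preimage, Set.mem_ofPred_eq, sub_sub_cancel]
        intro i; norm_num⟩)
  refine ⟨T, subset_closure.trans (hT.trans ?_)⟩
  exact Set.iUnion₂_mono fun x _ => Set.preimage_mono fun y hy i => ⟨(hy i).1.le, (hy i).2⟩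

/-- A translation invariant measure that is finite on the unit cube is a multiple of Lebesgue
measure. -/
lemma eq_unitCube_mul_volume (μ : Measure (Loc d)) (hfin : μ (unitCube d) ≠ ∞)
    (hinv : ∀ (x : Loc d) (B : Set (Loc d)), MeasurableSet B → μ ((fun y => y - x) ⁻¹' B) = μ B)
    (B : Set (Loc d)) : μ B = μ (unitCube d) * volume B := by
  have : IsFiniteMeasureOnCompacts μ := ⟨fun K hK => by
    obtain ⟨T, hT⟩ := exists_finset_subset_iUnion_unitCube hK.isBounded
    refine (measure_mono hT).trans_lt ((measure_biUnion_finset_le _ _).trans_lt ?_)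
    refine ENNReal.sum_lt_top.2 fun x _ => ?_
    rw [hinv x _ measurableSet_unitCube]
    exact hfin.lt_top⟩
  have : μ.IsAddLeftInvariant := ⟨fun g => by
    ext B hB
    rw [Measure.map_apply (measurable_const_add g) hB, ← hinv (-g) B hB]
    simp [add_comm]⟩
  -- Uniqueness of Haar measure; evaluation on the cube, of volume one, identifies the factor.
  have h := Measure.isAddLeftInvariant_eq_smul μ volume
  rw [h, Measure.smul_apply, Measure.smul_apply, volume_unitCube, ENNReal.smul_def,
    ENNReal.smul_def, smul_eq_mul, smul_eq_mul, mul_one]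

end UnitCube

/-! ### Consequences of stationarity for first and second moments -/

section Moments

variable {d : ℕ} {M : Type*} [MeasurableSpace M] {Ω : Type*} [MeasurableSpace Ω]
  {P : Measure Ω} {X : Ω → Config d M}

lemma toMeasure_shift (x : Loc d) (φ : Config d M) :
    (φ.shift x).toMeasure = φ.toMeasure.map fun z => (z.1 - x, z.2) := rfl

lemma IsStationary.lintegral_shift (hstat : IsStationary P X) {F : Config d M → ℝ≥0∞}
    (hF : Measurable F) (x : Loc d) :
    ∫⁻ ω, F ((X ω).shift x) ∂P = ∫⁻ ω, F (X ω) ∂P :=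
  ((hstat x).comp hF).lintegral_eq

/-- For fixed `C` the mean measure of the locations with mark in `C` is translation invariant, hence
a multiple of Lebesgue measure. -/
lemma IsStationary.lintegral_rect (hX : Measurable X) (hstat : IsStationary P X) {C : Set M}
    (hC : MeasurableSet C) (hfin : ∫⁻ ω, (X ω).toMeasure (unitCube d ×ˢ C) ∂P ≠ ∞)
    {B : Set (Loc d)} (hB : MeasurableSet B) :
    ∫⁻ ω, (X ω).toMeasure (B ×ˢ C) ∂P =
      (∫⁻ ω, (X ω).toMeasure (unitCube d ×ˢ C) ∂P) * volume B := by
  have hm : Measurable fun ω => (X ω).toMeasure := measurable_toMeasure.comp hX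
  let μ : Measure (Loc d) :=
    ((P.bind fun ω => (X ω).toMeasure).restrict (Set.univ ×ˢ C)).map Prod.fst
  have hμ {A : Set (Loc d)} (hA : MeasurableSet A) :
      μ A = ∫⁻ ω, (X ω).toMeasure (A ×ˢ C) ∂P := by
    rw [Measure.map_apply measurable_fst hA, Measure.restrict_apply (measurable_fst hA),
      ← Set.prod_univ, Set.prod_inter_prod, Set.inter_univ, Set.univ_inter,
      Measure.bind_apply (hA.prod hC) hm.aemeasurable]
  rw [← hμ hB, ← hμ measurableSet_unitCube]
  refine eq_unitCube_mul_volume μ (by rwa [hμ measurableSet_unitCube]) (fun x A hA => ?_) B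
  have hA' : MeasurableSet ((fun y => y - x) ⁻¹' A) := (measurable_sub_const x) hA
  rw [hμ hA', hμ hA]
  refine (lintegral_congr fun ω => ?_).trans (hstat.lintegral_shift
    ((Measure.measurable_coe (hA.prod hC)).comp measurable_toMeasure) x)
  rw [Function.comp_apply, toMeasure_shift,
    Measure.map_apply (measurable_shiftMap x) (hA.prod hC)]
  rfl

lemma lintegral_sq_add_lt_top {f g : Ω → ℝ≥0∞} (hf : Measurable f)
    (hff : ∫⁻ ω, f ω ^ 2 ∂P < ∞) (hgg : ∫⁻ ω, g ω ^ 2 ∂P < ∞) :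
    ∫⁻ ω, (f ω + g ω) ^ 2 ∂P < ∞ := by
  have h (ω : Ω) : (f ω + g ω) ^ 2 ≤ 4 * (f ω ^ 2 + g ω ^ 2) := by
    rcases le_total (f ω) (g ω) with hle | hle
    · calc (f ω + g ω) ^ 2 ≤ (g ω + g ω) ^ 2 := by gcongr
        _ = 4 * g ω ^ 2 := by ring
        _ ≤ _ := by gcongr; exact le_add_self
    · calc (f ω + g ω) ^ 2 ≤ (f ω + f ω) ^ 2 := by gcongr
        _ = 4 * f ω ^ 2 := by ring
        _ ≤ _ := by gcongr; exact le_self_add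
  refine (lintegral_mono h).trans_lt ?_
  rw [lintegral_const_mul' _ _ (by simp), lintegral_add_left (hf.pow_const 2)]
  exact ENNReal.mul_lt_top (by simp) (ENNReal.add_lt_top.2 ⟨hff, hgg⟩)

/-- Finitely many translated cubes cover `B`, and the count in each has the law of the count in the
unit cube. -/
lemma IsStationary.lintegral_sq_lt_top (hX : Measurable X) (hstat : IsStationary P X)
    (hsq : ∫⁻ ω, (X ω).toMeasure (unitCube d ×ˢ Set.univ) ^ 2 ∂P < ∞)
    {B : Set (Loc d)} (hB : Bornology.IsBounded B) :
    ∫⁻ ω, (X ω).toMeasure (B ×ˢ Set.univ) ^ 2 ∂P < ∞ := by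
  have hm {A : Set (Loc d)} (hA : MeasurableSet A) :
      Measurable fun φ : Config d M => φ.toMeasure (A ×ˢ Set.univ) :=
    (Measure.measurable_coe (hA.prod MeasurableSet.univ)).comp measurable_toMeasure
  have hcube (x : Loc d) : MeasurableSet ((fun y => y - x) ⁻¹' unitCube d) :=
    (measurable_sub_const x) measurableSet_unitCube
  obtain ⟨T, hT⟩ := exists_finset_subset_iUnion_unitCube hB
  have hle (ω : Ω) : (X ω).toMeasure (B ×ˢ Set.univ) ≤
      ∑ x ∈ T, (X ω).toMeasure (((fun y => y - x) ⁻¹' unitCube d) ×ˢ Set.univ) := by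
    refine (measure_mono ?_).trans (measure_biUnion_finset_le T _)
    rintro z ⟨hz, -⟩
    simpa using hT hz
  refine (lintegral_mono fun ω => pow_le_pow_left₀ zero_le (hle ω) 2).trans_lt ?_
  clear hle hT
  classical
  induction T using Finset.induction_on with
  | empty => simp
  | insert x T hx ih =>
    simp_rw [Finset.sum_insert hx]
    refine lintegral_sq_add_lt_top ((hm (hcube x)).comp hX) ?_ ih
    refine lt_of_eq_of_lt ?_ hsq
    rw [← hstat.lintegral_shift ((hm measurableSet_unitCube).pow_const 2) x]
    refine lintegral_congr fun ω => ?_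
    rw [toMeasure_shift, Measure.map_apply (measurable_shiftMap x)
      (measurableSet_unitCube.prod MeasurableSet.univ)]
    rfl

lemma locFactorialMoment_apply {A : Set (Loc d × Loc d)} (hA : MeasurableSet A) :
    locFactorialMoment P X A = factorialMoment P X ((fun p => (p.1.1, p.2.1)) ⁻¹' A) :=
  Measure.map_apply (by fun_prop) hA

end Moments

/-! ### The factorial moment measure and its reduction -/

section FactorialMoment

variable {d : ℕ} {M : Type*} [TopologicalSpace M] [PolishSpace M] [MeasurableSpace M] [BorelSpace M]
  {Ω : Type*} [MeasurableSpace Ω] {P : Measure Ω} {X : Ω → Config d M}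

lemma measurableSet_offDiag {α : Type*} [MeasurableSpace α] [MeasurableEq α] :
    MeasurableSet {p : α × α | p.1 ≠ p.2} :=
  measurableSet_diagonal.compl

lemma factorialMoment_shift (hX : Measurable X) (hstat : IsStationary P X) (x : Loc d)
    {A : Set ((Loc d × M) × (Loc d × M))} (hA : MeasurableSet A) :
    factorialMoment P X
      (Prod.map (fun z => (z.1 - x, z.2)) (fun z => (z.1 - x, z.2)) ⁻¹' A) =
      factorialMoment P X A := by
  have hT : Measurable (Prod.map (fun z : Loc d × M => (z.1 - x, z.2))
    (fun z : Loc d × M => (z.1 - x, z.2))) := (measurable_shiftMap x).prodMap (measurable_shiftMap x)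
  rw [factorialMoment_apply hX hA, factorialMoment_apply hX (hT hA)]
  refine (lintegral_congr fun ω => ?_).trans (hstat.lintegral_shift
    ((Measure.measurable_coe (hA.inter measurableSet_offDiag)).comp measurable_toMeasure_prod) x)
  rw [Function.comp_apply, toMeasure_shift, Measure.map_prod_map _ _ (measurable_shiftMap x)
    (measurable_shiftMap x), Measure.map_apply hT (hA.inter measurableSet_offDiag)]
  congr 1
  ext p
  simp [Prod.ext_iff]

/-- Needed because `covIntegrand` contains `D × M` where the expansion of the covariance produces `M
× D`. -/
lemma factorialMoment_swap (hX : Measurable X) {A B : Set (Loc d × M)} (hA : MeasurableSet A)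
    (hB : MeasurableSet B) : factorialMoment P X (A ×ˢ B) = factorialMoment P X (B ×ˢ A) := by
  rw [factorialMoment_apply hX (hA.prod hB), factorialMoment_apply hX (hB.prod hA)]
  refine lintegral_congr fun ω => ?_
  conv_lhs => rw [← Measure.prod_swap]
  rw [Measure.map_apply measurable_swap ((hA.prod hB).inter measurableSet_offDiag)]
  congr 1
  ext p
  simp [and_comm, eq_comm]

lemma locFactorialMoment_prod_lt_top (hX : Measurable X) (hstat : IsStationary P X)
    (hsq : ∫⁻ ω, (X ω).toMeasure (unitCube d ×ˢ Set.univ) ^ 2 ∂P < ∞)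
    {B : Set (Loc d)} (hB : Bornology.IsBounded B) (hBm : MeasurableSet B) :
    locFactorialMoment P X (B ×ˢ B) < ∞ := by
  rw [locFactorialMoment_apply (hBm.prod hBm), factorialMoment_apply hX
    ((show Measurable fun p : (Loc d × M) × (Loc d × M) => (p.1.1, p.2.1) by fun_prop)
      (hBm.prod hBm))]
  refine (lintegral_mono fun ω => ?_).trans_lt (hstat.lintegral_sq_lt_top hX hsq hB)
  rw [sq, ← Measure.prod_prod]
  refine measure_mono fun p hp => ?_
  simpa using hp.1

/-- The image of the second factorial moment measure of the locations under `(x, y) ↦ (x, y - x)`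
is the product of Lebesgue measure and `λ` times the reduced second factorial moment measure. -/
lemma map_locFactorialMoment (hX : Measurable X) (hstat : IsStationary P X)
    (hsq : ∫⁻ ω, (X ω).toMeasure (unitCube d ×ˢ Set.univ) ^ 2 ∂P < ∞)
    (h0 : intensity P X ≠ 0) (htop : intensity P X ≠ ∞) :
    SigmaFinite (intensity P X • reducedMoment P X) ∧
    (locFactorialMoment P X).map (fun p => (p.1, p.2 - p.1)) =
      volume.prod (intensity P X • reducedMoment P X) := by
  have hsub : Measurable fun p : Loc d × Loc d => (p.1, p.2 - p.1) := by fun_prop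
  have hred : intensity P X • reducedMoment P X =
      ((locFactorialMoment P X).restrict (unitCube d ×ˢ Set.univ)).map fun p => p.2 - p.1 := by
    rw [reducedMoment, smul_smul, ENNReal.mul_inv_cancel h0 htop, one_smul]
  rw [hred]
  set γ := ((locFactorialMoment P X).restrict (unitCube d ×ˢ Set.univ)).map fun p => p.2 - p.1
  set β := (locFactorialMoment P X).map (fun p => (p.1, p.2 - p.1))
  have hγ {U : Set (Loc d)} (hU : MeasurableSet U) : γ U = β (unitCube d ×ˢ U) := by
    rw [Measure.map_apply (by fun_prop) hU, Measure.restrict_apply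
      ((show Measurable fun p : Loc d × Loc d => p.2 - p.1 by fun_prop) hU),
      Measure.map_apply hsub (measurableSet_unitCube.prod hU)]
    congr 1
    ext p
    simp [and_comm]
  have hball (n : ℕ) : MeasurableSet (Metric.closedBall (0 : Loc d) n) :=
    Metric.isClosed_closedBall.measurableSet
  have hfin (n : ℕ) : γ (Metric.closedBall 0 n) < ∞ := by
    obtain ⟨r, hr⟩ := (isBounded_unitCube (d := d)).exists_norm_le
    rw [hγ (hball n), Measure.map_apply hsub (measurableSet_unitCube.prod (hball n))]
    refine (measure_mono fun p hp => ?_).trans_lt (locFactorialMoment_prod_lt_top hX hstat hsq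
      (Metric.isBounded_closedBall (x := (0 : Loc d)) (r := r + n))
      Metric.isClosed_closedBall.measurableSet)
    obtain ⟨h1, h2⟩ := hp
    have h3 := hr _ h1
    simp only [Metric.mem_closedBall, dist_zero_right, Set.mem_prod] at h2 h3 ⊢
    have hn : (0 : ℝ) ≤ n := n.cast_nonneg
    have h4 := norm_le_norm_add_norm_sub' p.2 p.1
    constructor <;> linarith
  have hmono : Monotone fun n : ℕ => Metric.closedBall (0 : Loc d) n := fun _ _ h =>
    Metric.closedBall_subset_closedBall (by exact_mod_cast h)
  have hunion : ⋃ n : ℕ, Metric.closedBall (0 : Loc d) n = Set.univ :=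
    Metric.iUnion_closedBall_nat 0
  have hσ : SigmaFinite γ := ⟨⟨⟨_, fun _ => trivial, hfin, hunion⟩⟩⟩
  refine ⟨hσ, (Measure.prod_eq fun s t hs ht => ?_).symm⟩
  -- With the difference confined to a fixed bounded set `U`, the measure `A ↦ β (A × U)` is
  -- translation invariant and finite on the unit cube, where its value is `γ U`. Letting `n` grow
  -- removes the truncation.
  have hcase (n : ℕ) : β (s ×ˢ (t ∩ Metric.closedBall 0 n)) =
      volume s * γ (t ∩ Metric.closedBall 0 n) := by
    have hU : MeasurableSet (t ∩ Metric.closedBall (0 : Loc d) n) := ht.inter (hball n)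
    set U := t ∩ Metric.closedBall (0 : Loc d) n
    let μ : Measure (Loc d) := (β.restrict (Set.univ ×ˢ U)).map Prod.fst
    have hμ {A : Set (Loc d)} (hA : MeasurableSet A) : μ A = β (A ×ˢ U) := by
      rw [Measure.map_apply measurable_fst hA, Measure.restrict_apply (measurable_fst hA),
        ← Set.prod_univ, Set.prod_inter_prod, Set.inter_univ, Set.univ_inter]
    rw [← hμ hs, hγ hU, ← hμ measurableSet_unitCube, mul_comm]
    refine eq_unitCube_mul_volume μ ?_ (fun x A hA => ?_) s
    · rw [hμ measurableSet_unitCube, ← hγ hU]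
      exact ((measure_mono Set.inter_subset_right).trans_lt (hfin n)).ne
    · have hA' : MeasurableSet ((fun y => y - x) ⁻¹' A) := (measurable_sub_const x) hA
      rw [hμ hA', hμ hA, Measure.map_apply hsub (hA'.prod hU), Measure.map_apply hsub (hA.prod hU),
        locFactorialMoment_apply (hsub (hA'.prod hU)), locFactorialMoment_apply (hsub (hA.prod hU)),
        ← factorialMoment_shift hX hstat x (A := _ ⁻¹' (_ ⁻¹' (A ×ˢ U)))]
      · congr 1
        ext p
        simp
      · exact (show Measurable fun p : (Loc d × M) × (Loc d × M) => (p.1.1, p.2.1) by fun_prop)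
          (hsub (hA.prod hU))
  rw [measure_eq_iSup_restrict γ hmono hunion ht, ENNReal.mul_iSup,
    measure_eq_iSup_restrict β (s := fun n : ℕ => Set.univ ×ˢ Metric.closedBall (0 : Loc d) n)
      (fun _ _ h => Set.prod_mono le_rfl (hmono h))
      (by rw [← Set.prod_iUnion, hunion, Set.univ_prod_univ]) (hs.prod ht)]
  refine iSup_congr fun n => ?_
  rw [Measure.restrict_apply ht, Measure.restrict_apply (hs.prod ht), Set.prod_inter_prod,
    Set.inter_univ, hcase]

end FactorialMoment

end MPP

namespace MPP

/-! ### Overlap of a large convex window with its translates -/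

section Geometry

variable {d : ℕ}

/-- A convex set containing a ball of radius `r` contains, with its translate by `-u`, a copy of
itself shrunk by the factor `1 - ‖u‖ / r`. -/
lemma pow_mul_volume_le_volume_inter {W : Set (Loc d)} (hW : Convex ℝ W) {c u : Loc d} {r : ℝ}
    (hr : 0 < r) (hball : Metric.closedBall c r ⊆ W) (hu : ‖u‖ ≤ r) :
    ENNReal.ofReal ((1 - ‖u‖ / r) ^ d) * volume W ≤
      volume (W ∩ (fun y => y + u) ⁻¹' W) := by
  set t := ‖u‖ / r with ht
  have ht0 : 0 ≤ t := by positivity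
  have ht1 : 0 ≤ 1 - t := by rw [sub_nonneg, ht, div_le_one hr]; exact hu
  -- Adding `u` to `(1 - t) w + t c` replaces `c` by `c + u / t`. Since `t = ‖u‖ / r`, this point
  -- has distance `r` from `c` and still lies in the ball; the case `u = 0` is separate.
  have hsub : AffineMap.homothety c (1 - t) '' W ⊆ W ∩ (fun y => y + u) ⁻¹' W := by
    rintro _ ⟨w, hw, rfl⟩
    have hc : c ∈ W := hball (Metric.mem_closedBall_self hr.le)
    have h1 : AffineMap.homothety c (1 - t) w = (1 - t) • w + t • c := by
      rw [AffineMap.homothety_apply, vsub_eq_sub, vadd_eq_add]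
      module
    have h2 : (1 - t) • w + t • c ∈ W := hW hw hc ht1 ht0 (by ring)
    rw [h1]
    refine ⟨h2, ?_⟩
    rcases eq_or_ne u 0 with rfl | hne
    · simpa using h2
    have hn : 0 < ‖u‖ := norm_pos_iff.2 hne
    have htp : 0 < t := div_pos hn hr
    have h3 : c + t⁻¹ • u ∈ W := hball (by
      rw [Metric.mem_closedBall, dist_eq_norm, add_sub_cancel_left, norm_smul, norm_inv,
        Real.norm_of_nonneg ht0, ht]
      exact le_of_eq (by field_simp))
    have h4 : (1 - t) • w + t • c + u = (1 - t) • w + t • (c + t⁻¹ • u) := by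
      rw [smul_add, smul_inv_smul₀ htp.ne', add_assoc]
    rw [Set.mem_preimage, h4]
    exact hW hw h3 ht1 ht0 (by ring)
  refine le_trans (le_of_eq ?_) (measure_mono hsub)
  rw [Measure.addHaar_image_homothety, finrank_euclideanSpace_fin, abs_of_nonneg (by positivity)]

variable {W : ℕ → Set (Loc d)}

lemma IsConvexAveraging.eventually_closedBall_subset (hW : IsConvexAveraging W) (r : ℝ) :
    ∀ᶠ k in atTop, ∃ c, Metric.closedBall c r ⊆ W k := by
  filter_upwards [hW.inradius_tendsto.eventually_const_lt (ENNReal.ofReal_lt_top (r := r))]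
    with k hk
  obtain ⟨_, ⟨s, hs, rfl, c, -, hc⟩, hlt⟩ := lt_sSup_iff.1 hk
  exact ⟨c, (Metric.closedBall_subset_closedBall
    ((ENNReal.ofReal_lt_ofReal_iff hs).1 hlt).le).trans hc⟩

lemma IsConvexAveraging.eventually_volume_pos (hW : IsConvexAveraging W) :
    ∀ᶠ k in atTop, 0 < volume.real (W k) := by
  filter_upwards [hW.eventually_closedBall_subset 1] with k ⟨c, hc⟩
  exact ENNReal.toReal_pos ((Metric.measure_closedBall_pos volume c one_pos).trans_le
    (measure_mono hc)).ne' (hW.compact k).measure_lt_top.ne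

/-- The ratio is at most `1`, and at least `(1 - ‖u‖ / r) ^ d` once the window contains a ball of
radius `r ≥ ‖u‖`; `r` is arbitrarily large. -/
lemma IsConvexAveraging.tendsto_volume_inter_div (hW : IsConvexAveraging W) (u : Loc d) :
    Tendsto (fun k => volume.real (W k ∩ (fun y => y + u) ⁻¹' W k) / volume.real (W k))
      atTop (𝓝 1) := by
  refine tendsto_order.2 ⟨fun a ha => ?_, fun a ha => ?_⟩
  · have hlim : Tendsto (fun r : ℝ => (1 - ‖u‖ / r) ^ d) atTop (𝓝 1) := by
      have h := ((tendsto_const_nhds (x := ‖u‖)).div_atTop tendsto_id).const_sub 1 |>.pow d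
      simpa using h
    obtain ⟨r, har, hr0, hru⟩ := ((hlim.eventually_const_lt ha).and
      ((eventually_gt_atTop 0).and (eventually_ge_atTop ‖u‖))).exists
    filter_upwards [hW.eventually_closedBall_subset r, hW.eventually_volume_pos] with k ⟨c, hc⟩ hk
    refine har.trans_le ((le_div_iff₀ hk).2 ?_)
    have h := ENNReal.toReal_mono
      (measure_ne_top_of_subset Set.inter_subset_left (hW.compact k).measure_lt_top.ne)
      (pow_mul_volume_le_volume_inter (hW.convex k) hr0 hc hru)
    have ht1 : 0 ≤ 1 - ‖u‖ / r := by rw [sub_nonneg, div_le_one hr0]; exact hru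
    rwa [ENNReal.toReal_mul, ENNReal.toReal_ofReal (by positivity)] at h
  · refine Eventually.of_forall fun k => lt_of_le_of_lt ?_ ha
    exact div_le_one_of_le₀ (measureReal_mono Set.inter_subset_left
      (hW.compact k).measure_lt_top.ne) measureReal_nonneg

end Geometry

/-! ### Moments under independent marking -/

section IndependentMarking

variable {d : ℕ} {M : Type*} [MeasurableSpace M] {Ω : Type*} [MeasurableSpace Ω]
  {P : Measure Ω} {X : Ω → Config d M}

lemma lintegral_infinitePi_indicator (Q : Measure M) [IsProbabilityMeasure Q] (n : ℕ) {C : Set M}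
    (hC : MeasurableSet C) :
    ∫⁻ s, C.indicator 1 (s n) ∂(Measure.infinitePi fun _ : ℕ => Q) = Q C := by
  rw [(measurePreserving_eval_infinitePi (fun _ : ℕ => Q) n).lintegral_comp
    (measurable_one.indicator hC), lintegral_indicator_one hC]

lemma lintegral_infinitePi_indicator_mul (Q : Measure M) [IsProbabilityMeasure Q] (n m : ℕ)
    {C D : Set M} (hC : MeasurableSet C) (hD : MeasurableSet D) :
    ∫⁻ s, C.indicator 1 (s n) * D.indicator 1 (s m) ∂(Measure.infinitePi fun _ : ℕ => Q) =
      if n = m then Q (C ∩ D) else Q C * Q D := by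
  split_ifs with h
  · subst h
    rw [← lintegral_infinitePi_indicator Q n (hC.inter hD)]
    simp_rw [Set.inter_indicator_one, Pi.mul_apply]
  · have hi : IndepFun (fun s : ℕ → M => C.indicator (1 : M → ℝ≥0∞) (s n))
        (fun s : ℕ → M => D.indicator (1 : M → ℝ≥0∞) (s m))
        (Measure.infinitePi fun _ : ℕ => Q) :=
      ((iIndepFun_infinitePi (P := fun _ : ℕ => Q) (X := fun _ x => x)
        (fun _ => measurable_id)).indepFun h).comp
        (measurable_one.indicator hC) (measurable_one.indicator hD)
    refine (lintegral_mul_eq_lintegral_mul_lintegral_of_indepFun''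
      ((measurable_one.indicator hC).comp (measurable_pi_apply n)).aemeasurable
      ((measurable_one.indicator hD).comp (measurable_pi_apply m)).aemeasurable hi).trans ?_
    simp_rw [Function.comp_apply]
    rw [lintegral_infinitePi_indicator Q n hC, lintegral_infinitePi_indicator Q m hD]

/-- Expand the counts as sums over the indices of the points. Equal indices share one mark and give
`Q (C ∩ D)`; distinct ones have independent marks and give `Q C * Q D`. Here `N` and `T` are the
first and the second factorial moment of the number of points in `B`, and do not depend on the
marks. -/
lemma IsIndependentlyMarked.exists_moments [IsProbabilityMeasure P] (hX : Measurable X)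
    (h : IsIndependentlyMarked P X) : ∃ Q : Measure M, IsProbabilityMeasure Q ∧
    ∀ B : Set (Loc d), MeasurableSet B → ∃ N T : ℝ≥0∞,
      (∀ C, MeasurableSet C → ∫⁻ ω, (X ω).toMeasure (B ×ˢ C) ∂P = N * Q C) ∧
      ∀ C D, MeasurableSet C → MeasurableSet D →
        ∫⁻ ω, (X ω).toMeasure (B ×ˢ C) * (X ω).toMeasure (B ×ˢ D) ∂P =
          N * Q (C ∩ D) + T * (Q C * Q D) := by
  obtain ⟨ν, Q, hν, hQ, heq⟩ := h
  refine ⟨Q, hQ, fun B hB => ?_⟩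
  set π := Measure.infinitePi fun _ : ℕ => Q
  set F : (ℕ∞ × (ℕ → Loc d)) × (ℕ → M) → Measure (Loc d × M) := fun s =>
    Measure.sum fun n : ℕ => if (n : ℕ∞) < s.1.1 then Measure.dirac (s.1.2 n, s.2 n) else 0
    with hF
  have hm : Measurable fun ω => (X ω).toMeasure := measurable_toMeasure.comp hX
  have heq' : P.map (fun ω => (X ω).toMeasure) = (ν.prod π).map F := heq
  -- The image under a map that is not a.e. measurable is zero by convention, whereas this image is
  -- a probability measure.
  have hFm : AEMeasurable F (ν.prod π) := by
    have := Measure.isProbabilityMeasure_map (μ := P) hm.aemeasurable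
    refine aemeasurable_of_map_neZero ⟨?_⟩
    rw [← heq']
    exact IsProbabilityMeasure.ne_zero _
  have htrans {G : Measure (Loc d × M) → ℝ≥0∞} (hG : Measurable G) :
      ∫⁻ ω, G (X ω).toMeasure ∂P = ∫⁻ s, G (F s) ∂(ν.prod π) := by
    rw [← lintegral_map hG hm, heq', lintegral_map' hG.aemeasurable hFm]
  let a (n : ℕ) : ℕ∞ × (ℕ → Loc d) → ℝ≥0∞ :=
    {t | (n : ℕ∞) < t.1 ∧ t.2 n ∈ B}.indicator 1
  have ha (n : ℕ) : Measurable (a n) := by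
    refine measurable_one.indicator (MeasurableSet.inter ?_ ?_)
    · exact measurable_fst (MeasurableSet.of_discrete (s := Set.Ioi (n : ℕ∞)))
    · exact ((measurable_pi_apply n).comp measurable_snd) hB
  have hb (n : ℕ) {C : Set M} (hC : MeasurableSet C) :
      Measurable fun s : ℕ → M => C.indicator (1 : M → ℝ≥0∞) (s n) :=
    (measurable_one.indicator hC).comp (measurable_pi_apply n)
  have hFa {C : Set M} (hC : MeasurableSet C) (s) :
      F s (B ×ˢ C) = ∑' n, a n s.1 * C.indicator 1 (s.2 n) := by
    rw [hF, Measure.sum_apply _ (hB.prod hC)]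
    refine tsum_congr fun n => ?_
    by_cases h1 : (n : ℕ∞) < s.1.1
    · rw [if_pos h1, Measure.dirac_apply' _ (hB.prod hC)]
      by_cases h2 : s.1.2 n ∈ B <;> by_cases h3 : s.2 n ∈ C <;> simp [a, h1, h2, h3]
    · simp [a, h1]
  refine ⟨∑' n, ∫⁻ t, a n t ∂ν, ∑' n, ∑' m, if n = m then 0 else ∫⁻ t, a n t * a m t ∂ν,
    fun C hC => ?_, fun C D hC hD => ?_⟩
  · rw [htrans (Measure.measurable_coe (hB.prod hC))]
    simp_rw [hFa hC]
    have hterm (n : ℕ) : Measurable fun s : (ℕ∞ × (ℕ → Loc d)) × (ℕ → M) =>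
        a n s.1 * C.indicator (1 : M → ℝ≥0∞) (s.2 n) :=
      ((ha n).comp measurable_fst).mul ((hb n hC).comp measurable_snd)
    rw [lintegral_tsum fun n => (hterm n).aemeasurable, ← ENNReal.tsum_mul_right]
    refine tsum_congr fun n => ?_
    rw [lintegral_prod_mul (f := a n) (g := fun s : ℕ → M => C.indicator 1 (s n)) (ha n).aemeasurable
      (hb n hC).aemeasurable, lintegral_infinitePi_indicator Q n hC]
  · refine (htrans ((Measure.measurable_coe (hB.prod hC)).mul
      (Measure.measurable_coe (hB.prod hD)))).trans ?_
    simp_rw [Pi.mul_apply]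
    have hterm (n m : ℕ) : Measurable fun s : (ℕ∞ × (ℕ → Loc d)) × (ℕ → M) =>
        (a n s.1 * a m s.1) * (C.indicator (1 : M → ℝ≥0∞) (s.2 n) * D.indicator 1 (s.2 m)) :=
      (((ha n).mul (ha m)).comp measurable_fst).mul
        (((hb n hC).mul (hb m hD)).comp measurable_snd)
    have hmul (s) : F s (B ×ˢ C) * F s (B ×ˢ D) = ∑' n, ∑' m, (a n s.1 * a m s.1) *
        (C.indicator (1 : M → ℝ≥0∞) (s.2 n) * D.indicator 1 (s.2 m)) := by
      rw [hFa hC, hFa hD, ← ENNReal.tsum_mul_right]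
      refine tsum_congr fun n => ?_
      rw [← ENNReal.tsum_mul_left]
      exact tsum_congr fun m => by ring
    simp_rw [hmul]
    rw [lintegral_tsum fun n => (Measurable.tsum fun m => hterm n m).aemeasurable,
      ← ENNReal.tsum_mul_right, ← ENNReal.tsum_mul_right, ← ENNReal.tsum_add]
    refine tsum_congr fun n => ?_
    rw [lintegral_tsum fun m => (hterm n m).aemeasurable, ← ENNReal.tsum_mul_right]
    have hint (m : ℕ) : ∫⁻ s, (a n s.1 * a m s.1) *
        (C.indicator (1 : M → ℝ≥0∞) (s.2 n) * D.indicator 1 (s.2 m)) ∂(ν.prod π) =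
        (if m = n then (∫⁻ t, a n t ∂ν) * Q (C ∩ D) else 0) +
          (if n = m then 0 else ∫⁻ t, a n t * a m t ∂ν) * (Q C * Q D) := by
      rw [lintegral_prod_mul (f := fun t => a n t * a m t)
        (g := fun s : ℕ → M => C.indicator 1 (s n) * D.indicator 1 (s m)) ((ha n).mul (ha m)).aemeasurable
        ((hb n hC).mul (hb m hD)).aemeasurable, lintegral_infinitePi_indicator_mul Q n m hC hD]
      by_cases hnm : n = m
      · subst hnm
        have hsq (t) : a n t * a n t = a n t := by
          by_cases h1 : t ∈ {t : ℕ∞ × (ℕ → Loc d) | (n : ℕ∞) < t.1 ∧ t.2 n ∈ B}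
          · simp only [a, Set.indicator_of_mem h1, Pi.one_apply, mul_one]
          · simp only [a, Set.indicator_of_notMem h1, mul_zero]
        simp [hsq]
      · simp [hnm, Ne.symm hnm]
    simp_rw [hint]
    rw [ENNReal.tsum_add, tsum_ite_eq]

end IndependentMarking

end MPP

namespace MPP

/-! ### Integrals of four-term combinations -/

section LinearCombination

lemma integral_sub_sub_add {α : Type*} [MeasurableSpace α] {μ : Measure α} {f₁ f₂ f₃ f₄ : α → ℝ}
    (h₁ : Integrable f₁ μ) (h₂ : Integrable f₂ μ) (h₃ : Integrable f₃ μ) (h₄ : Integrable f₄ μ)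
    (a b c : ℝ) :
    ∫ x, f₁ x - a * f₂ x - b * f₃ x + c * f₄ x ∂μ =
      ∫ x, f₁ x ∂μ - a * ∫ x, f₂ x ∂μ - b * ∫ x, f₃ x ∂μ + c * ∫ x, f₄ x ∂μ := by
  have h₁₂ : Integrable (fun x => f₁ x - a * f₂ x) μ := h₁.sub (h₂.const_mul a)
  have h₁₂₃ : Integrable (fun x => f₁ x - a * f₂ x - b * f₃ x) μ := h₁₂.sub (h₃.const_mul b)
  rw [integral_add h₁₂₃ (h₄.const_mul c), integral_sub h₁₂ (h₃.const_mul b),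
    integral_sub h₁ (h₂.const_mul a), integral_const_mul, integral_const_mul, integral_const_mul]

end LinearCombination

/-! ### Covariances of deviations through mixed moments -/

section Covariance

variable {d : ℕ} {M : Type*} [MeasurableSpace M] {Ω : Type*} [MeasurableSpace Ω]
  {P : Measure Ω} {X : Ω → Config d M}

lemma intensity_lt_top [IsProbabilityMeasure P]
    (hsq : ∫⁻ ω, (X ω).toMeasure (unitCube d ×ˢ Set.univ) ^ 2 ∂P < ∞) : intensity P X < ∞ := by
  have h (a : ℝ≥0∞) : a ≤ 1 + a ^ 2 := by
    rcases le_total a 1 with ha | ha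
    · exact ha.trans le_self_add
    · calc a = a * 1 := (mul_one a).symm
        _ ≤ a * a := by gcongr
        _ = a ^ 2 := (sq a).symm
        _ ≤ _ := le_add_self
  refine (lintegral_mono fun ω => h ((X ω).toMeasure (unitCube d ×ˢ Set.univ))).trans_lt ?_
  rw [lintegral_add_left measurable_const]
  simpa using hsq

lemma lintegral_unitCube_lt_top (htop : intensity P X < ∞) (C : Set M) :
    ∫⁻ ω, (X ω).toMeasure (unitCube d ×ˢ C) ∂P < ∞ :=
  (lintegral_mono fun _ => measure_mono (Set.prod_mono le_rfl (Set.subset_univ C))).trans_lt htop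

lemma toReal_lintegral_unitCube (h0 : intensity P X ≠ 0) (htop : intensity P X < ∞) (C : Set M) :
    (∫⁻ ω, (X ω).toMeasure (unitCube d ×ˢ C) ∂P).toReal =
      (intensity P X).toReal * palmMark P X C := by
  have h : palmMark P X C =
    ((intensity P X)⁻¹ * ∫⁻ ω, (X ω).toMeasure (unitCube d ×ˢ C) ∂P).toReal := rfl
  rw [h, ← ENNReal.toReal_mul, ← mul_assoc, ENNReal.mul_inv_cancel h0 htop.ne, one_mul]

lemma palmMark_univ (h0 : intensity P X ≠ 0) (htop : intensity P X < ∞) :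
    palmMark P X Set.univ = 1 := by
  have h : palmMark P X Set.univ = ((intensity P X)⁻¹ * intensity P X).toReal := rfl
  rw [h, ENNReal.inv_mul_cancel h0 htop.ne, ENNReal.toReal_one]

lemma deviation_eq {W : Set (Loc d)} (hb : Bornology.IsBounded W) (hW : MeasurableSet W)
    {C : Set M} (hC : MeasurableSet C) (ω : Ω) :
    deviation P X W C ω = (√(volume.real W))⁻¹ * ((X ω).toMeasure.real (W ×ˢ C) -
      palmMark P X C * (X ω).toMeasure.real (W ×ˢ Set.univ)) := by
  have hi {D : Set M} (hD : MeasurableSet D) :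
      Integrable ((W ×ˢ D).indicator fun _ => (1 : ℝ)) (X ω).toMeasure :=
    (integrable_indicator_iff (hW.prod hD)).2 (integrableOn_const ((X ω).lt_top hb hW D).ne)
  have hfun : (fun z : Loc d × M => W.indicator (fun _ => (1 : ℝ)) z.1 *
      (C.indicator (fun _ => (1 : ℝ)) z.2 - palmMark P X C)) = fun z =>
      (W ×ˢ C).indicator (fun _ => (1 : ℝ)) z -
        palmMark P X C * (W ×ˢ Set.univ).indicator (fun _ => (1 : ℝ)) z := by
    funext z
    by_cases h1 : z.1 ∈ W <;> by_cases h2 : z.2 ∈ C <;> simp [h1, h2, Set.indicator]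
  have h : deviation P X W C ω = (√(volume.real W))⁻¹ * ∫ z, W.indicator (fun _ => (1 : ℝ)) z.1 *
      (C.indicator (fun _ => (1 : ℝ)) z.2 - palmMark P X C) ∂(X ω).toMeasure := rfl
  rw [h, hfun, integral_sub (hi hC) ((hi MeasurableSet.univ).const_mul _), integral_const_mul,
    integral_indicator_const _ (hW.prod hC), integral_indicator_const _ (hW.prod MeasurableSet.univ)]
  simp

/-- The mixed second moment `E φ(W × C) φ(W × D)`. -/
noncomputable def mixedMoment (P : Measure Ω) (X : Ω → Config d M) (W : Set (Loc d)) (C D : Set M) : ℝ≥0∞ :=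
  ∫⁻ ω, (X ω).toMeasure (W ×ˢ C) * (X ω).toMeasure (W ×ˢ D) ∂P

lemma mixedMoment_lt_top (hX : Measurable X) (hstat : IsStationary P X)
    (hsq : ∫⁻ ω, (X ω).toMeasure (unitCube d ×ˢ Set.univ) ^ 2 ∂P < ∞)
    {W : Set (Loc d)} (hb : Bornology.IsBounded W) (C D : Set M) :
    mixedMoment P X W C D < ∞ := by
  refine (lintegral_mono fun ω => ?_).trans_lt (hstat.lintegral_sq_lt_top hX hsq hb)
  rw [sq]
  exact mul_le_mul' (measure_mono (Set.prod_mono le_rfl (Set.subset_univ C)))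
    (measure_mono (Set.prod_mono le_rfl (Set.subset_univ D)))

lemma measurable_toMeasure_rect (hX : Measurable X) {W : Set (Loc d)} (hW : MeasurableSet W)
    {C : Set M} (hC : MeasurableSet C) :
    Measurable fun ω => (X ω).toMeasure (W ×ˢ C) :=
  (Measure.measurable_coe (hW.prod hC)).comp (measurable_toMeasure.comp hX)

lemma integrable_real_mul_real (hX : Measurable X) (hstat : IsStationary P X)
    (hsq : ∫⁻ ω, (X ω).toMeasure (unitCube d ×ˢ Set.univ) ^ 2 ∂P < ∞)
    {W : Set (Loc d)} (hb : Bornology.IsBounded W) (hW : MeasurableSet W)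
    {C D : Set M} (hC : MeasurableSet C) (hD : MeasurableSet D) :
    Integrable (fun ω => (X ω).toMeasure.real (W ×ˢ C) * (X ω).toMeasure.real (W ×ˢ D)) P := by
  simp_rw [measureReal_def, ← ENNReal.toReal_mul]
  exact integrable_toReal_of_lintegral_ne_top
    ((measurable_toMeasure_rect hX hW hC).mul (measurable_toMeasure_rect hX hW hD)).aemeasurable
    (mixedMoment_lt_top hX hstat hsq hb C D).ne

lemma integral_real_mul_real (hX : Measurable X)
    {W : Set (Loc d)} (hb : Bornology.IsBounded W) (hW : MeasurableSet W)
    {C D : Set M} (hC : MeasurableSet C) (hD : MeasurableSet D) :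
    ∫ ω, (X ω).toMeasure.real (W ×ˢ C) * (X ω).toMeasure.real (W ×ˢ D) ∂P =
      (mixedMoment P X W C D).toReal := by
  simp_rw [measureReal_def, ← ENNReal.toReal_mul]
  exact integral_toReal
    ((measurable_toMeasure_rect hX hW hC).mul (measurable_toMeasure_rect hX hW hD)).aemeasurable
    (ae_of_all _ fun ω => ENNReal.mul_lt_top ((X ω).lt_top hb hW C) ((X ω).lt_top hb hW D))

/-- The second moments of the deviations in terms of the mixed second moments of the counts. -/
lemma integrable_and_integral_deviation_mul (hX : Measurable X) (hstat : IsStationary P X)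
    (hsq : ∫⁻ ω, (X ω).toMeasure (unitCube d ×ˢ Set.univ) ^ 2 ∂P < ∞)
    {W : Set (Loc d)} (hb : Bornology.IsBounded W) (hW : MeasurableSet W)
    {C D : Set M} (hC : MeasurableSet C) (hD : MeasurableSet D) :
    Integrable (fun ω => deviation P X W C ω * deviation P X W D ω) P ∧
    ∫ ω, deviation P X W C ω * deviation P X W D ω ∂P = (volume.real W)⁻¹ *
      ((mixedMoment P X W C D).toReal - palmMark P X D * (mixedMoment P X W C Set.univ).toReal -
        palmMark P X C * (mixedMoment P X W Set.univ D).toReal +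
        palmMark P X C * palmMark P X D * (mixedMoment P X W Set.univ Set.univ).toReal) := by
  have hU : MeasurableSet (Set.univ : Set M) := MeasurableSet.univ
  have hfun : (fun ω => deviation P X W C ω * deviation P X W D ω) = fun ω => (volume.real W)⁻¹ *
      ((X ω).toMeasure.real (W ×ˢ C) * (X ω).toMeasure.real (W ×ˢ D) -
        palmMark P X D * ((X ω).toMeasure.real (W ×ˢ C) * (X ω).toMeasure.real (W ×ˢ Set.univ)) -
        palmMark P X C * ((X ω).toMeasure.real (W ×ˢ Set.univ) * (X ω).toMeasure.real (W ×ˢ D)) +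
        palmMark P X C * palmMark P X D * ((X ω).toMeasure.real (W ×ˢ Set.univ) *
          (X ω).toMeasure.real (W ×ˢ Set.univ))) := by
    funext ω
    rw [deviation_eq hb hW hC, deviation_eq hb hW hD]
    have hs : (volume.real W)⁻¹ = (√(volume.real W))⁻¹ * (√(volume.real W))⁻¹ := by
      rw [← mul_inv, Real.mul_self_sqrt measureReal_nonneg]
    rw [hs]
    ring
  have i₁ := integrable_real_mul_real hX hstat hsq hb hW hC hD
  have i₂ := integrable_real_mul_real hX hstat hsq hb hW hC hU
  have i₃ := integrable_real_mul_real hX hstat hsq hb hW hU hD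
  have i₄ := integrable_real_mul_real hX hstat hsq hb hW hU hU
  rw [hfun]
  refine ⟨(((i₁.sub (i₂.const_mul _)).sub (i₃.const_mul _)).add (i₄.const_mul _)).const_mul _, ?_⟩
  rw [integral_const_mul, integral_sub_sub_add i₁ i₂ i₃ i₄,
    integral_real_mul_real hX hb hW hC hD, integral_real_mul_real hX hb hW hC hU,
    integral_real_mul_real hX hb hW hU hD, integral_real_mul_real hX hb hW hU hU]

/-- In the combination of four mixed moments the `T` terms carry weights `1 - 1 - 1 + 1` and cancel.
The `N` terms, with `N = λ |W|`, leave the covariance of the mark indicators. -/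
lemma IsIndependentlyMarked.integral_deviation_mul [IsProbabilityMeasure P] (hX : Measurable X)
    (hstat : IsStationary P X) (h0 : intensity P X ≠ 0)
    (hsq : ∫⁻ ω, (X ω).toMeasure (unitCube d ×ˢ Set.univ) ^ 2 ∂P < ∞)
    (hind : IsIndependentlyMarked P X)
    {W : Set (Loc d)} (hb : Bornology.IsBounded W) (hW : MeasurableSet W) (hpos : 0 < volume.real W)
    {C D : Set M} (hC : MeasurableSet C) (hD : MeasurableSet D) :
    ∫ ω, deviation P X W C ω * deviation P X W D ω ∂P =
      (intensity P X).toReal * (palmMark P X (C ∩ D) - palmMark P X C * palmMark P X D) := by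
  have hU : MeasurableSet (Set.univ : Set M) := MeasurableSet.univ
  have htop := intensity_lt_top hsq
  obtain ⟨Q, hQ, hmom⟩ := hind.exists_moments hX
  -- The unit cube serves only to identify `Q` with the Palm mark distribution.
  obtain ⟨N₀, -, hN₀, -⟩ := hmom _ measurableSet_unitCube
  obtain ⟨N, T, hN, hT⟩ := hmom W hW
  have hN₀' : N₀ = intensity P X := by
    have h := hN₀ Set.univ hU
    rw [measure_univ, mul_one] at h
    exact h.symm
  have hpalm {C : Set M} (hC : MeasurableSet C) : palmMark P X C = Q.real C := by
    have h : palmMark P X C =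
      ((intensity P X)⁻¹ * ∫⁻ ω, (X ω).toMeasure (unitCube d ×ˢ C) ∂P).toReal := rfl
    rw [h, hN₀ C hC, hN₀', ← mul_assoc, ENNReal.inv_mul_cancel h0 htop.ne, one_mul,
      measureReal_def]
  have hN' : N = intensity P X * volume W := by
    have h := hN Set.univ hU
    rw [measure_univ, mul_one, hstat.lintegral_rect hX hU htop.ne hW] at h
    exact h.symm
  have hmm {C D : Set M} (hC : MeasurableSet C) (hD : MeasurableSet D) :
      mixedMoment P X W C D = N * Q (C ∩ D) + T * (Q C * Q D) := hT C D hC hD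
  have hNtop : N ≠ ∞ := hN' ▸ (ENNReal.mul_lt_top htop hb.measure_lt_top).ne
  have hTtop : T ≠ ∞ := by
    have h := mixedMoment_lt_top hX hstat hsq hb (Set.univ : Set M) Set.univ
    rw [hmm hU hU, measure_univ, mul_one, mul_one] at h
    exact (le_add_self.trans_lt h).ne
  have hreal {C D : Set M} (hC : MeasurableSet C) (hD : MeasurableSet D) :
      (mixedMoment P X W C D).toReal = (intensity P X).toReal * volume.real W * Q.real (C ∩ D) +
        T.toReal * (Q.real C * Q.real D) := by
    rw [hmm hC hD, ENNReal.toReal_add (ENNReal.mul_ne_top hNtop (measure_ne_top _ _))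
      (ENNReal.mul_ne_top hTtop (ENNReal.mul_ne_top (measure_ne_top _ _) (measure_ne_top _ _))),
      ENNReal.toReal_mul, ENNReal.toReal_mul, ENNReal.toReal_mul, hN', ENNReal.toReal_mul]
    rfl
  rw [(integrable_and_integral_deviation_mul hX hstat hsq hb hW hC hD).2, hreal hC hD, hreal hC hU,
    hreal hU hD, hreal hU hU, hpalm hC, hpalm hD, hpalm (hC.inter hD), Set.inter_univ,
    Set.univ_inter, Set.univ_inter, probReal_univ]
  field_simp
  ring

/-- As `p(M) = 1`, the integrand equals `[κ(C × D) - p(C) p(D)] - p(D) [κ(C × M) - p(C)] - p(C) [κ(D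
× M) - p(D)]`, and the hypothesis bounds each bracket. The separate terms need not be integrable. -/
lemma integrable_covIntegrand (h0 : intensity P X ≠ 0) (htop : intensity P X < ∞)
    {κ : Kernel (Loc d) (M × M)}
    (hint : ∀ C₁ C₂ : Set M, MeasurableSet C₁ → MeasurableSet C₂ →
      ∫⁻ x, ENNReal.ofReal |(κ x).real (C₁ ×ˢ C₂) - palmMark P X C₁ * palmMark P X C₂|
          ∂(reducedMoment P X) < ∞)
    {C D : Set M} (hC : MeasurableSet C) (hD : MeasurableSet D) :
    Integrable (covIntegrand P X κ C D) (reducedMoment P X) := by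
  have hi {C D : Set M} (hC : MeasurableSet C) (hD : MeasurableSet D) :
      Integrable (fun x => (κ x).real (C ×ˢ D) - palmMark P X C * palmMark P X D)
        (reducedMoment P X) := by
    refine ⟨((κ.measurable_coe (hC.prod hD)).ennreal_toReal.sub_const _).aestronglyMeasurable, ?_⟩
    rw [hasFiniteIntegral_iff_norm]
    exact hint C D hC hD
  refine (((hi hC hD).sub ((hi hC MeasurableSet.univ).const_mul (palmMark P X D))).sub
    ((hi hD MeasurableSet.univ).const_mul (palmMark P X C))).congr (ae_of_all _ fun x => ?_)
  simp only [covIntegrand, Pi.sub_apply, palmMark_univ h0 htop]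
  ring

end Covariance

/-! ### The covariance in a window through two-point Palm marks -/

section PalmFormula

variable {d : ℕ} {M : Type*} [TopologicalSpace M] [PolishSpace M] [MeasurableSpace M] [BorelSpace M]
  {Ω : Type*} [MeasurableSpace Ω] {P : Measure Ω} {X : Ω → Config d M}

lemma mixedMoment_eq_add (hX : Measurable X) (hsimple : IsSimple P X) (hstat : IsStationary P X)
    (htop : intensity P X < ∞)
    {W : Set (Loc d)} (hW : MeasurableSet W) {C D : Set M} (hC : MeasurableSet C)
    (hD : MeasurableSet D) :
    mixedMoment P X W C D =
      (∫⁻ ω, (X ω).toMeasure (unitCube d ×ˢ (C ∩ D)) ∂P) * volume W +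
        factorialMoment P X ((W ×ˢ C) ×ˢ (W ×ˢ D)) := by
  rw [← hstat.lintegral_rect hX (hC.inter hD) (lintegral_unitCube_lt_top htop _).ne hW,
    factorialMoment_apply hX ((hW.prod hC).prod (hW.prod hD)),
    ← lintegral_add_left (measurable_toMeasure_rect hX hW (hC.inter hD))]
  refine lintegral_congr_ae ?_
  filter_upwards [hsimple] with ω hω
  rw [(X ω).mul_eq_add hω (hW.prod hC) (hW.prod hD), Set.prod_inter_prod, Set.inter_self]

lemma measurableSet_inter_translate {W : Set (Loc d)} (hW : MeasurableSet W) :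
    MeasurableSet {q : Loc d × Loc d | q.1 ∈ W ∧ q.1 + q.2 ∈ W} :=
  (measurable_fst hW).inter ((measurable_fst.add measurable_snd) hW)

lemma measurable_volume_inter {W : Set (Loc d)} (hW : MeasurableSet W) :
    Measurable fun u : Loc d => volume (W ∩ (fun y => y + u) ⁻¹' W) :=
  measurable_measure_prodMk_right (μ := (volume : Measure (Loc d)))
    (measurableSet_inter_translate hW)

/-- In the coordinates `(x, u) = (x, y - x)` the kernel depends on `u` only, and integrating `x`
over the positions with `x` and `x + u` both in `W` yields the overlap volume. -/
lemma factorialMoment_rect_eq_lintegral (hX : Measurable X) (hstat : IsStationary P X)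
    (hsq : ∫⁻ ω, (X ω).toMeasure (unitCube d ×ˢ Set.univ) ^ 2 ∂P < ∞)
    (h0 : intensity P X ≠ 0) (htop : intensity P X < ∞)
    {κ : Kernel (Loc d) (M × M)} (hκ : IsTwoPointPalm P X κ)
    {W : Set (Loc d)} (hW : MeasurableSet W) {C D : Set M} (hC : MeasurableSet C)
    (hD : MeasurableSet D) :
    factorialMoment P X ((W ×ˢ C) ×ˢ (W ×ˢ D)) = intensity P X *
      ∫⁻ u, volume (W ∩ (fun y => y + u) ⁻¹' W) * κ u (C ×ˢ D) ∂(reducedMoment P X) := by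
  obtain ⟨hσ, hmap⟩ := map_locFactorialMoment hX hstat hsq h0 htop.ne
  set S : Set (Loc d × Loc d) := {q | q.1 ∈ W ∧ q.1 + q.2 ∈ W}
  have hS : MeasurableSet S := measurableSet_inter_translate hW
  have hκm : Measurable fun u => κ u (C ×ˢ D) := κ.measurable_coe (hC.prod hD)
  have hG : Measurable (S.indicator fun q => κ q.2 (C ×ˢ D)) :=
    (hκm.comp measurable_snd).indicator hS
  have hsub : Measurable fun p : Loc d × Loc d => (p.1, p.2 - p.1) := by fun_prop
  rw [hκ.2 W W C D hW hW hC hD, ← lintegral_indicator (hW.prod hW)]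
  have hfun (p : Loc d × Loc d) :
      (W ×ˢ W).indicator (fun p : Loc d × Loc d => κ (p.2 - p.1) (C ×ˢ D)) p =
        S.indicator (fun q => κ q.2 (C ×ˢ D)) (p.1, p.2 - p.1) := by
    have hpre : W ×ˢ W = (fun p : Loc d × Loc d => (p.1, p.2 - p.1)) ⁻¹' S := by
      ext p
      simp [S]
    rw [hpre]
    rfl
  simp_rw [hfun]
  rw [← lintegral_map hG hsub, hmap, lintegral_prod_symm' _ hG, lintegral_smul_measure,
    smul_eq_mul]
  congr 1
  refine lintegral_congr fun u => ?_
  have hSu : MeasurableSet (W ∩ (fun y => y + u) ⁻¹' W) := hW.inter ((measurable_add_const u) hW)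
  have hin (x : Loc d) : S.indicator (fun q => κ q.2 (C ×ˢ D)) (x, u) =
      (W ∩ (fun y => y + u) ⁻¹' W).indicator (fun _ => κ u (C ×ˢ D)) x := rfl
  simp_rw [hin]
  rw [lintegral_indicator_const hSu, mul_comm]

/-- The covariance of the deviations in a window, by the two-point Palm mark distribution. -/
lemma integral_deviation_mul_eq (hX : Measurable X) (hsimple : IsSimple P X)
    (hstat : IsStationary P X)
    (hsq : ∫⁻ ω, (X ω).toMeasure (unitCube d ×ˢ Set.univ) ^ 2 ∂P < ∞)
    (h0 : intensity P X ≠ 0) (htop : intensity P X < ∞)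
    {κ : Kernel (Loc d) (M × M)} (hκ : IsTwoPointPalm P X κ)
    {W : Set (Loc d)} (hb : Bornology.IsBounded W) (hW : MeasurableSet W)
    {C D : Set M} (hC : MeasurableSet C) (hD : MeasurableSet D) :
    ∫ ω, deviation P X W C ω * deviation P X W D ω ∂P = (volume.real W)⁻¹ *
      ((intensity P X).toReal * (palmMark P X (C ∩ D) - palmMark P X C * palmMark P X D) *
        volume.real W + (intensity P X).toReal *
        ∫ u, volume.real (W ∩ (fun y => y + u) ⁻¹' W) * covIntegrand P X κ C D u
          ∂(reducedMoment P X)) := by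
  have hU : MeasurableSet (Set.univ : Set M) := MeasurableSet.univ
  have := hκ.1
  set w : Loc d → ℝ := fun u => volume.real (W ∩ (fun y => y + u) ⁻¹' W) with hw
  have hvtop (u : Loc d) : volume (W ∩ (fun y => y + u) ⁻¹' W) < ∞ :=
    (hb.subset Set.inter_subset_left).measure_lt_top
  have hfm {C D : Set M} (hC : MeasurableSet C) (hD : MeasurableSet D) :
      factorialMoment P X ((W ×ˢ C) ×ˢ (W ×ˢ D)) < ∞ :=
    (le_add_self.trans_eq (mixedMoment_eq_add hX hsimple hstat htop hW hC hD).symm).trans_lt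
      (mixedMoment_lt_top hX hstat hsq hb C D)
  have hmeas {C D : Set M} (hC : MeasurableSet C) (hD : MeasurableSet D) :
      AEMeasurable (fun u => volume (W ∩ (fun y => y + u) ⁻¹' W) * κ u (C ×ˢ D))
        (reducedMoment P X) :=
    ((measurable_volume_inter hW).mul (κ.measurable_coe (hC.prod hD))).aemeasurable
  -- With the weight `w` each term is integrable by itself, since its integral times `λ ≠ 0` is a
  -- finite factorial moment. This permits the termwise expansion in `hcov`, whose last term uses
  -- `κ(M × M) = 1`.
  have hint {C D : Set M} (hC : MeasurableSet C) (hD : MeasurableSet D) :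
      Integrable (fun u => w u * (κ u).real (C ×ˢ D)) (reducedMoment P X) := by
    simp_rw [hw, measureReal_def, ← ENNReal.toReal_mul]
    refine integrable_toReal_of_lintegral_ne_top (hmeas hC hD) fun hcon => ?_
    have h := hfm hC hD
    rw [factorialMoment_rect_eq_lintegral hX hstat hsq h0 htop hκ hW hC hD, hcon,
      ENNReal.mul_top h0] at h
    exact h.ne rfl
  have hfac {C D : Set M} (hC : MeasurableSet C) (hD : MeasurableSet D) :
      (factorialMoment P X ((W ×ˢ C) ×ˢ (W ×ˢ D))).toReal =
        (intensity P X).toReal * ∫ u, w u * (κ u).real (C ×ˢ D) ∂(reducedMoment P X) := by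
    rw [factorialMoment_rect_eq_lintegral hX hstat hsq h0 htop hκ hW hC hD, ENNReal.toReal_mul,
      ← integral_toReal (hmeas hC hD)
        (ae_of_all _ fun u => ENNReal.mul_lt_top (hvtop u) (measure_lt_top _ _))]
    simp_rw [ENNReal.toReal_mul]
    rfl
  have hmix {C D : Set M} (hC : MeasurableSet C) (hD : MeasurableSet D) :
      (mixedMoment P X W C D).toReal =
        (intensity P X).toReal * palmMark P X (C ∩ D) * volume.real W +
          (factorialMoment P X ((W ×ˢ C) ×ˢ (W ×ˢ D))).toReal := by
    rw [mixedMoment_eq_add hX hsimple hstat htop hW hC hD, ENNReal.toReal_add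
      (ENNReal.mul_lt_top (lintegral_unitCube_lt_top htop _) hb.measure_lt_top).ne (hfm hC hD).ne,
      ENNReal.toReal_mul, toReal_lintegral_unitCube h0 htop]
    rfl
  have hcov : ∫ u, w u * covIntegrand P X κ C D u ∂(reducedMoment P X) =
      (∫ u, w u * (κ u).real (C ×ˢ D) ∂(reducedMoment P X)) -
        palmMark P X D * (∫ u, w u * (κ u).real (C ×ˢ Set.univ) ∂(reducedMoment P X)) -
        palmMark P X C * (∫ u, w u * (κ u).real (D ×ˢ Set.univ) ∂(reducedMoment P X)) +
        palmMark P X C * palmMark P X D *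
          (∫ u, w u * (κ u).real (Set.univ ×ˢ Set.univ) ∂(reducedMoment P X)) := by
    rw [← integral_sub_sub_add (hint hC hD) (hint hC hU) (hint hD hU) (hint hU hU)]
    refine integral_congr_ae (ae_of_all _ fun u => ?_)
    simp only [covIntegrand, Set.univ_prod_univ, probReal_univ]
    ring
  rw [(integrable_and_integral_deviation_mul hX hstat hsq hb hW hC hD).2, hcov, hmix hC hD,
    hmix hC hU, hmix hU hD, hmix hU hU,
    factorialMoment_swap hX (hW.prod hU) (hW.prod hD), hfac hC hD, hfac hC hU, hfac hD hU,
    hfac hU hU, Set.inter_univ, Set.univ_inter, Set.univ_inter, palmMark_univ h0 htop]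
  ring

end PalmFormula

end MPP

/-! ### The limiting covariance -/

theorem theorem2 {d : ℕ} {M : Type*} [TopologicalSpace M] [PolishSpace M] [MeasurableSpace M]
    [BorelSpace M] {Ω : Type*} [MeasurableSpace Ω] (P : Measure Ω) [IsProbabilityMeasure P]
    (X : Ω → MPP.Config d M) (hX : Measurable X) (hsimple : MPP.IsSimple P X)
    (hstat : MPP.IsStationary P X) (hpos : 0 < MPP.intensity P X)
    (hsq : ∫⁻ ω, (X ω).1 (MPP.unitCube d ×ˢ Set.univ) ^ 2 ∂P < ∞)
    (κ : Kernel (MPP.Loc d) (M × M)) (hκ : MPP.IsTwoPointPalm P X κ)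
    (hint : ∀ C₁ C₂ : Set M, MeasurableSet C₁ → MeasurableSet C₂ →
      ∫⁻ x, ENNReal.ofReal
        |(κ x).real (C₁ ×ˢ C₂) - MPP.palmMark P X C₁ * MPP.palmMark P X C₂|
          ∂(MPP.reducedMoment P X) < ∞)
    (W : ℕ → Set (MPP.Loc d)) (hW : MPP.IsConvexAveraging W)
    {l : ℕ} (C : Fin l → Set M) (hC : ∀ i, MeasurableSet (C i)) (i j : Fin l) :
    (∀ k, Integrable
      (fun ω => MPP.deviation P X (W k) (C i) ω * MPP.deviation P X (W k) (C j) ω) P) ∧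
    Integrable (MPP.covIntegrand P X κ (C i) (C j)) (MPP.reducedMoment P X) ∧
    Tendsto
      (fun k => ∫ ω, MPP.deviation P X (W k) (C i) ω * MPP.deviation P X (W k) (C j) ω ∂P)
      atTop
      (𝓝 ((MPP.intensity P X).toReal *
          (MPP.palmMark P X (C i ∩ C j) - MPP.palmMark P X (C i) * MPP.palmMark P X (C j))
        + (MPP.intensity P X).toReal *
          ∫ x, MPP.covIntegrand P X κ (C i) (C j) x ∂(MPP.reducedMoment P X))) ∧
    (MPP.IsIndependentlyMarked P X →
      Tendsto
        (fun k => ∫ ω, MPP.deviation P X (W k) (C i) ω * MPP.deviation P X (W k) (C j) ω ∂P)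
        atTop
        (𝓝 ((MPP.intensity P X).toReal *
          (MPP.palmMark P X (C i ∩ C j) - MPP.palmMark P X (C i) * MPP.palmMark P X (C j))))) := by
  have hbd (k : ℕ) : Bornology.IsBounded (W k) := (hW.compact k).isBounded
  have hWm (k : ℕ) : MeasurableSet (W k) := (hW.compact k).isClosed.measurableSet
  have htop : MPP.intensity P X < ∞ := MPP.intensity_lt_top hsq
  have hcov := MPP.integrable_covIntegrand hpos.ne' htop hint (hC i) (hC j)
  refine ⟨fun k => (MPP.integrable_and_integral_deviation_mul hX hstat hsq (hbd k) (hWm k)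
    (hC i) (hC j)).1, hcov, ?_, fun hind => ?_⟩
  · have hlim : Tendsto (fun k => ∫ u, volume.real (W k ∩ (fun y => y + u) ⁻¹' W k) /
        volume.real (W k) * MPP.covIntegrand P X κ (C i) (C j) u ∂(MPP.reducedMoment P X)) atTop
        (𝓝 (∫ u, MPP.covIntegrand P X κ (C i) (C j) u ∂(MPP.reducedMoment P X))) := by
      refine tendsto_integral_of_dominated_convergence
        (fun u => ‖MPP.covIntegrand P X κ (C i) (C j) u‖) (fun k => ?_) hcov.norm (fun k => ?_) ?_
      · exact ((MPP.measurable_volume_inter (hWm k)).ennreal_toReal.div_const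
          _).aestronglyMeasurable.mul hcov.aestronglyMeasurable
      · refine ae_of_all _ fun u => ?_
        rw [norm_mul, Real.norm_of_nonneg (by positivity)]
        exact mul_le_of_le_one_left (norm_nonneg _) (div_le_one_of_le₀
          (measureReal_mono Set.inter_subset_left (hbd k).measure_lt_top.ne) measureReal_nonneg)
      · refine ae_of_all _ fun u => ?_
        simpa using (hW.tendsto_volume_inter_div u).mul_const _
    refine ((hlim.const_mul (MPP.intensity P X).toReal).const_add ((MPP.intensity P X).toReal *
      (MPP.palmMark P X (C i ∩ C j) - MPP.palmMark P X (C i) * MPP.palmMark P X (C j)))).congr' ?_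
    -- The exact window formula turns into the convergent expression after division by `|W_k|`,
    -- which is positive for large `k`.
    filter_upwards [hW.eventually_volume_pos] with k hk
    rw [MPP.integral_deviation_mul_eq hX hsimple hstat hsq hpos.ne' htop hκ (hbd k) (hWm k)
      (hC i) (hC j)]
    simp_rw [div_mul_eq_mul_div, integral_div]
    field_simp
  · refine tendsto_const_nhds.congr' ?_
    filter_upwards [hW.eventually_volume_pos] with k hk
    exact (hind.integral_deviation_mul hX hstat hpos.ne' hsq (hbd k) (hWm k) hk (hC i) (hC j)).symm
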